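/- All spaces are real. For a unit vector $x$ of a normed space $\mathbb{E}$ let $J(x)=\{f\in\mathbb{E}^*:\|f\|=1,\ f(x)=1\}$. The vector $x$ is called smooth if $J(x)$ is a singleton, and $k$-smooth ($k\in\mathbb{N}$) if $\dim\operatorname{span}J(x)=k$; an operator of norm one is $k$-smooth if it is so as a unit vector of the space of bounded linear operators with the operator norm. Let $\mathbb{X}=\ell_\infty^3$, let $\mathbb{Y}$ be a two-dimensional Banach space with unit sphere $S_{\mathbb{Y}}$, and let $T:\mathbb{X}\to\mathbb{Y}$ be a linear operator with $\|T\|=1$. Put $M_T=\{x\in\mathbb{X}:\|x\|=1,\ \|Tx\|=\|T\|\}$, let $Ext(B_{\mathbb{X}})$ be the set of extreme points of the closed unit ball of $\mathbb{X}$, and let $x_1=(1,1,1)$, $x_2=(-1,1,1)$, $x_3=(-1,-1,1)$, $x_4=(1,-1,1)$. Suppose that $M_T\cap Ext(B_{\mathbb{X}})=\{\pm x_1,\pm x_2,\pm x_3,\pm x_4\}$, and let $S_1=\{x_i: 1\le i\le 4,\ Tx_i \text{ is smooth}\}$. Then the following hold. (I) Let $|S_1|=4$. (a) If either $\operatorname{rank}(T)=1$,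 or for all $i\neq j$ in $\{1,2,3,4\}$ the points $Tx_i,Tx_j$ or the points $Tx_i,-Tx_j$ belong to a common (possibly degenerate) line segment contained in $S_{\mathbb{Y}}$, then $T$ is $3$-smooth. (b) Otherwise $T$ is $4$-smooth. (II) If $|S_1|=3$, then $T$ is $4$-smooth. (III) If $|S_1|=2$, then $T$ is $5$-smooth. (IV) If $|S_1|<2$, then $S_1=\emptyset$ and $T$ is $6$-smooth. -/

import Mathlib

/-- `J(x)`: the supporting linear functionals of a (unit) vector `x`. -/
def supportFunctionals {E : Type*} [NormedAddCommGroup E] [NormedSpace ℝ E] (x : E) :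
    Set (E →L[ℝ] ℝ) :=
  {f | ‖f‖ = 1 ∧ f x = 1}

/-- A unit vector is smooth if it has exactly one supporting linear functional. -/
def IsSmoothVector {E : Type*} [NormedAddCommGroup E] [NormedSpace ℝ E] (x : E) : Prop :=
  ‖x‖ = 1 ∧ ∃ f : E →L[ℝ] ℝ, supportFunctionals x = {f}

/-- A unit vector `x` is `k`-smooth if `dim span J(x) = k`. The dimension is taken as a cardinal,
so that an infinite-dimensional span is not `k`-smooth for any natural number `k`. For an operator
`T`, this is applied in the space of bounded operators with the operator norm. -/
def IsKSmooth {E : Type*} [NormedAddCommGroup E] [NormedSpace ℝ E] (k : ℕ) (x : E) : Prop :=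
  ‖x‖ = 1 ∧ Module.rank ℝ (Submodule.span ℝ (supportFunctionals x)) = (k : Cardinal)

/-- `M_T`: the unit vectors at which `T` attains its norm. -/
def normAttainmentSet {E F : Type*} [NormedAddCommGroup E] [NormedSpace ℝ E]
    [NormedAddCommGroup F] [NormedSpace ℝ F] (T : E →L[ℝ] F) : Set E :=
  {x | ‖x‖ = 1 ∧ ‖T x‖ = ‖T‖}

/-- `y` and `z` belong to the same straight line segment contained in the unit sphere. -/
def OnCommonSphereSegment {F : Type*} [NormedAddCommGroup F] [NormedSpace ℝ F] (y z : F) : Prop :=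
  ∃ a b : F, segment ℝ a b ⊆ Metric.sphere (0 : F) 1 ∧ y ∈ segment ℝ a b ∧ z ∈ segment ℝ a b

/-- The vertices `x₁, x₂, x₃, x₄` of the cube, one from each antipodal pair. The type
`Fin 3 → ℝ` carries the supremum norm, so it is `ℓ_∞³`. -/
def cubeVertex : Fin 4 → (Fin 3 → ℝ) :=
  ![![1, 1, 1], ![-1, 1, 1], ![-1, -1, 1], ![1, -1, 1]]

/-- `S₁`: the set of those `xᵢ` for which `T xᵢ` is smooth. -/
def smoothImageVertices {F : Type*} [NormedAddCommGroup F] [NormedSpace ℝ F]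
    (T : (Fin 3 → ℝ) →L[ℝ] F) : Set (Fin 3 → ℝ) :=
  {p | ∃ i : Fin 4, p = cubeVertex i ∧ IsSmoothVector (T (cubeVertex i))}

/-! Choose signs so that the four vertices `v i` satisfy `∑ v i = 0`, which up to scaling is their
only linear relation, and put `z i = T (v i)`. Since the unit ball is the convex hull of the `±v i`,
the map `A ↦ (A (v i))` embeds the operators isometrically in `Y⁴` with the maximum norm. By
Hahn–Banach a functional supporting `T` extends to `Y⁴`, and its components lie in the spans `V i`
of the functionals supporting `z i`. Thus span `J(T)` is the image of `∏ V i` under `g ↦ ∑ g i ∘ ev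
(v i)`. The kernel consists of the constant families, so `dim span J(T) = ∑ dim V i - dim ⋂ V i`.

As `Y` is a plane, `V i` is a line when `z i` is smooth and the whole dual otherwise; with `n`
smooth images the sum is `8 - n`. The intersection has dimension 2 for `n = 0`. For `n = 4` it has
dimension 1 or 0, according to whether the four lines coincide, which is the segment condition.

The remaining values of `n` rest on `alignedOrOpposite_of_add_eq_zero`: four unit vectors of a plane
with sum zero take values `±1` under one functional of norm at most one, or split into opposite
pairs. Hence for `0 < n < 4` the lines of the smooth vectors coincide and the dimension is `7 - n`,
while `n = 1` cannot occur. -/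

/-! ### Supporting functionals, smoothness and segments in the sphere -/

section SupportFunctionals

variable {E : Type*} [NormedAddCommGroup E] [NormedSpace ℝ E]

/-- The linear span of the supporting functionals of `x`. -/
def supportSpan (x : E) : Submodule ℝ (E →L[ℝ] ℝ) :=
  Submodule.span ℝ (supportFunctionals x)

theorem apply_le_one_of_norm_le_one {f : E →L[ℝ] ℝ} {x : E} (hf : ‖f‖ ≤ 1) (hx : ‖x‖ ≤ 1) :
    f x ≤ 1 :=
  (le_abs_self _).trans ((f.le_of_opNorm_le hf x).trans (by simpa using hx))

theorem mem_supportFunctionals_of_norm_le_one {f : E →L[ℝ] ℝ} {x : E} (hf : ‖f‖ ≤ 1)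
    (hx : ‖x‖ ≤ 1) (hfx : f x = 1) : f ∈ supportFunctionals x := by
  refine ⟨le_antisymm hf ?_, hfx⟩
  have h := f.le_opNorm x
  rw [hfx, norm_one] at h
  nlinarith [norm_nonneg f, norm_nonneg x]

theorem supportFunctionals_nonempty {x : E} (hx : ‖x‖ = 1) : (supportFunctionals x).Nonempty := by
  obtain ⟨f, hf, hfx⟩ := exists_dual_vector ℝ x (by rw [hx]; exact one_ne_zero)
  exact ⟨f, hf, by simpa [hx] using hfx⟩

theorem supportFunctionals_neg (x : E) : supportFunctionals (-x) = -supportFunctionals x := by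
  ext f
  simp [supportFunctionals]

theorem supportSpan_neg (x : E) : supportSpan (-x) = supportSpan x := by
  rw [supportSpan, supportFunctionals_neg, Submodule.span_neg, supportSpan]

theorem isSmoothVector_neg {x : E} : IsSmoothVector (-x) ↔ IsSmoothVector x := by
  have key : ∀ y : E, IsSmoothVector y → IsSmoothVector (-y) := by
    rintro y ⟨hy, f, hf⟩
    exact ⟨by rwa [norm_neg], -f, by rw [supportFunctionals_neg, hf, Set.neg_singleton]⟩
  exact ⟨fun h => by simpa using key _ h, key x⟩

theorem IsSmoothVector.supportFunctionals_eq {x : E} (hx : IsSmoothVector x) {f : E →L[ℝ] ℝ}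
    (hf : f ∈ supportFunctionals x) : supportFunctionals x = {f} := by
  obtain ⟨-, g, hg⟩ := hx
  rw [hg] at hf ⊢
  rw [Set.mem_singleton_iff.1 hf]

theorem IsSmoothVector.supportSpan_eq {x : E} (hx : IsSmoothVector x) {f : E →L[ℝ] ℝ}
    (hf : f ∈ supportFunctionals x) : supportSpan x = Submodule.span ℝ {f} := by
  rw [supportSpan, hx.supportFunctionals_eq hf]

theorem IsSmoothVector.finrank_supportSpan {x : E} (hx : IsSmoothVector x) :
    Module.finrank ℝ (supportSpan x) = 1 := by
  obtain ⟨f, hf⟩ := supportFunctionals_nonempty hx.1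
  rw [hx.supportSpan_eq hf]
  refine finrank_span_singleton ?_
  rintro rfl
  simpa using hf.1

theorem IsSmoothVector.supportSpan_eq_of_abs_apply_eq_one {x : E} (hx : IsSmoothVector x)
    {f : E →L[ℝ] ℝ} (hf : ‖f‖ ≤ 1) (hfx : |f x| = 1) : supportSpan x = Submodule.span ℝ {f} := by
  rcases eq_or_eq_neg_of_abs_eq hfx with h | h
  · exact hx.supportSpan_eq (mem_supportFunctionals_of_norm_le_one hf hx.1.le h)
  · rw [← supportSpan_neg]
    exact (isSmoothVector_neg.2 hx).supportSpan_eq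
      (mem_supportFunctionals_of_norm_le_one hf (by rw [norm_neg, hx.1]) (by simp [h]))

theorem two_le_finrank_supportSpan [FiniteDimensional ℝ E] {x : E} (hx : ‖x‖ = 1)
    (hns : ¬ IsSmoothVector x) : 2 ≤ Module.finrank ℝ (supportSpan x) := by
  obtain ⟨f, hf⟩ := supportFunctionals_nonempty hx
  obtain ⟨g, hg, hgf⟩ : ∃ g ∈ supportFunctionals x, g ≠ f := by
    by_contra! h
    exact hns ⟨hx, f, Set.eq_singleton_iff_unique_mem.2 ⟨hf, h⟩⟩
  have hli : LinearIndependent ℝ ![f, g] := by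
    rw [LinearIndependent.pair_iff]
    intro s t hst
    have h := congrArg (fun F : E →L[ℝ] ℝ => F x) hst
    simp only [add_apply, smul_apply, hf.2, hg.2, smul_eq_mul, mul_one, zero_apply] at h
    obtain rfl : s = -t := by linarith
    have h2 : t • (g - f) = 0 := by rw [← hst]; module
    rcases smul_eq_zero.1 h2 with h3 | h3
    · simp [h3]
    · exact absurd (sub_eq_zero.1 h3) hgf
  have h := finrank_span_eq_card hli
  rw [Fintype.card_fin] at h
  refine h.ge.trans (Submodule.finrank_mono (Submodule.span_mono ?_))
  rintro _ ⟨i, rfl⟩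
  fin_cases i
  exacts [hf, hg]

/-- A functional supporting the midpoint supports both points, because 1 is then the mean of two
values that are at most 1. Smoothness leaves no other supporting functional. -/
theorem OnCommonSphereSegment.supportSpan_eq {y z : E} (h : OnCommonSphereSegment y z)
    (hy : IsSmoothVector y) (hz : IsSmoothVector z) : supportSpan y = supportSpan z := by
  obtain ⟨a, b, hab, hya, hza⟩ := h
  have hm : midpoint ℝ y z ∈ segment ℝ a b :=
    (convex_segment a b).segment_subset hya hza (midpoint_mem_segment y z)
  obtain ⟨f, hf, hfm⟩ := supportFunctionals_nonempty (mem_sphere_zero_iff_norm.1 (hab hm))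
  have h1 := apply_le_one_of_norm_le_one hf.le hy.1.le
  have h2 := apply_le_one_of_norm_le_one hf.le hz.1.le
  rw [midpoint_eq_smul_add, map_smul, map_add, smul_eq_mul, invOf_eq_inv] at hfm
  rw [hy.supportSpan_eq (f := f) ⟨hf, by linarith⟩, hz.supportSpan_eq (f := f) ⟨hf, by linarith⟩]

theorem onCommonSphereSegment_of_mem_supportFunctionals {y z : E} {f : E →L[ℝ] ℝ}
    (hy : ‖y‖ = 1) (hz : ‖z‖ = 1) (hfy : f ∈ supportFunctionals y) (hfz : f ∈ supportFunctionals z) :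
    OnCommonSphereSegment y z := by
  refine ⟨y, z, ?_, left_mem_segment ℝ y z, right_mem_segment ℝ y z⟩
  rintro _ ⟨s, t, hs, ht, hst, rfl⟩
  rw [mem_sphere_zero_iff_norm]
  refine le_antisymm ?_ ?_
  · refine (norm_add_le _ _).trans ?_
    rw [norm_smul, norm_smul, hy, hz, Real.norm_of_nonneg hs, Real.norm_of_nonneg ht]
    linarith
  · have h := f.le_opNorm (s • y + t • z)
    rwa [hfy.1, one_mul, map_add, map_smul, map_smul, hfy.2, hfz.2, smul_eq_mul, smul_eq_mul,
      mul_one, mul_one, hst, norm_one] at h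

/-- Proportional functionals of norm one differ by a sign, and that sign decides between `z` and
`-z`. -/
theorem IsSmoothVector.onCommonSphereSegment {y z : E} (hy : IsSmoothVector y)
    (hz : IsSmoothVector z) (h : supportSpan y = supportSpan z) :
    OnCommonSphereSegment y z ∨ OnCommonSphereSegment y (-z) := by
  obtain ⟨f, hf⟩ := supportFunctionals_nonempty hy.1
  obtain ⟨g, hg⟩ := supportFunctionals_nonempty hz.1
  have hfg : f ∈ Submodule.span ℝ {g} := by
    rw [← hz.supportSpan_eq hg, ← h]
    exact Submodule.subset_span hf
  obtain ⟨c, rfl⟩ := Submodule.mem_span_singleton.1 hfg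
  have hc : |c| = 1 := by
    have := hf.1
    rwa [norm_smul, hg.1, mul_one, Real.norm_eq_abs] at this
  rcases eq_or_eq_neg_of_abs_eq hc with rfl | rfl
  · left
    exact onCommonSphereSegment_of_mem_supportFunctionals hy.1 hz.1 hf (by simpa using hg)
  · right
    refine onCommonSphereSegment_of_mem_supportFunctionals hy.1 (by rw [norm_neg, hz.1]) hf ?_
    rw [supportFunctionals_neg]
    simpa using hg

end SupportFunctionals

/-! ### Geometry of the unit sphere of a normed plane -/

section Plane

variable {Y : Type*} [NormedAddCommGroup Y] [NormedSpace ℝ Y]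

theorem finrank_continuousDual [FiniteDimensional ℝ Y] :
    Module.finrank ℝ (Y →L[ℝ] ℝ) = Module.finrank ℝ Y := by
  rw [← (LinearMap.toContinuousLinearMap (𝕜 := ℝ) (E := Y) (F' := ℝ)).finrank_eq]
  exact Subspace.dual_finrank_eq

theorem supportSpan_eq_top_of_not_isSmoothVector (hY : Module.finrank ℝ Y = 2) {x : Y}
    (hx : ‖x‖ = 1) (hns : ¬ IsSmoothVector x) : supportSpan x = ⊤ := by
  have : FiniteDimensional ℝ Y := .of_finrank_pos (by omega)
  refine Submodule.eq_top_of_finrank_eq (le_antisymm (Submodule.finrank_le _) ?_)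
  rw [finrank_continuousDual, hY]
  exact two_le_finrank_supportSpan hx hns

/-- In a plane, two independent vectors span. -/
theorem exists_eq_smul_add_smul (hY : Module.finrank ℝ Y = 2) {a b : Y}
    (hab : LinearIndependent ℝ ![a, b]) (z : Y) : ∃ s t : ℝ, z = s • a + t • b := by
  have : FiniteDimensional ℝ Y := .of_finrank_pos (by omega)
  have h := hab.span_eq_top_of_card_eq_finrank' (by simp [hY])
  have hz : z ∈ Submodule.span ℝ (Set.range ![a, b]) := by rw [h]; trivial
  rw [Matrix.range_cons, Matrix.range_cons, Matrix.range_empty, Set.union_empty,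
    Set.singleton_union, Submodule.mem_span_pair] at hz
  obtain ⟨s, t, h⟩ := hz
  exact ⟨s, t, h.symm⟩

theorem linearIndependent_pair_of_apply_eq_one {f : Y →L[ℝ] ℝ} {a b : Y} (ha : f a = 1)
    (hb : f b = 1) (hab : a ≠ b) : LinearIndependent ℝ ![a, b] := by
  rw [LinearIndependent.pair_iff]
  intro s t hst
  have h := congrArg f hst
  rw [map_add, map_smul, map_smul, ha, hb, map_zero, smul_eq_mul, smul_eq_mul] at h
  obtain rfl : s = -t := by linarith
  have h2 : t • (b - a) = 0 := by rw [← hst]; module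
  rcases smul_eq_zero.1 h2 with h3 | h3
  · simp [h3]
  · exact absurd (sub_eq_zero.1 h3).symm hab

/-- In a plane, the relative interior of a segment in the unit sphere consists of smooth points. -/
theorem isSmoothVector_of_openSegment (hY : Module.finrank ℝ Y = 2) {f : Y →L[ℝ] ℝ} {a b w : Y}
    (hf : ‖f‖ ≤ 1) (hfa : f a = 1) (hfb : f b = 1) (ha : ‖a‖ = 1) (hb : ‖b‖ = 1) (hab : a ≠ b)
    (hw : ‖w‖ = 1) (hwab : w ∈ openSegment ℝ a b) : IsSmoothVector w := by
  obtain ⟨s, t, hs, ht, hst, rfl⟩ := hwab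
  refine ⟨hw, f, Set.eq_singleton_iff_unique_mem.2
    ⟨mem_supportFunctionals_of_norm_le_one hf hw.le (by simp [hfa, hfb, hst]), ?_⟩⟩
  rintro g ⟨hg, hgw⟩
  have h1 := apply_le_one_of_norm_le_one hg.le ha.le
  have h2 := apply_le_one_of_norm_le_one hg.le hb.le
  rw [map_add, map_smul, map_smul, smul_eq_mul, smul_eq_mul] at hgw
  have hga : g a = 1 := by nlinarith
  have hgb : g b = 1 := by nlinarith
  ext z
  obtain ⟨p, q, rfl⟩ :=
    exists_eq_smul_add_smul hY (linearIndependent_pair_of_apply_eq_one hfa hfb hab) z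
  simp [hga, hgb, hfa, hfb]

/-- Four vectors are all mapped to `±1` by a functional of norm at most one, or the first of them
is opposite to one of the others. -/
def AlignedOrOpposite (z₁ z₂ z₃ z₄ : Y) : Prop :=
  (∃ f : Y →L[ℝ] ℝ, ‖f‖ ≤ 1 ∧ |f z₁| = 1 ∧ |f z₂| = 1 ∧ |f z₃| = 1 ∧ |f z₄| = 1) ∨
    z₁ = -z₂ ∨ z₁ = -z₃ ∨ z₁ = -z₄

/-- The coefficients of `-z₃` and `-z₄` in `z₁, z₂` are nonnegative and total 2, and the triangle
inequality makes each of the two coefficient sums at least 1. Both sums are therefore 1, so `-z₃`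
and `-z₄` lie on the segment from `z₁` to `z₂`. At its ends an opposite pair appears; inside, a
functional supporting `-z₃` takes the value 1 on the whole segment. -/
theorem alignedOrOpposite_of_mem_parallelogram {z₁ z₂ z₃ z₄ : Y} (h₁ : ‖z₁‖ = 1) (h₂ : ‖z₂‖ = 1)
    (h₃ : ‖z₃‖ = 1) (h₄ : ‖z₄‖ = 1) (hsum : z₁ + z₂ + z₃ + z₄ = 0) {s t : ℝ}
    (hs : s ∈ Set.Icc (0 : ℝ) 1) (ht : t ∈ Set.Icc (0 : ℝ) 1) (hz : -z₃ = s • z₁ + t • z₂) :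
    AlignedOrOpposite z₁ z₂ z₃ z₄ := by
  obtain ⟨hs0, hs1⟩ := hs
  obtain ⟨ht0, ht1⟩ := ht
  have hz' : -z₄ = (1 - s) • z₁ + (1 - t) • z₂ := by
    have e : -z₄ = z₁ + z₂ - -z₃ := by rw [← sub_eq_zero, ← neg_eq_zero, ← hsum]; module
    rw [e, hz]; module
  have key : ∀ {p q : ℝ} {w : Y}, 0 ≤ p → 0 ≤ q → ‖w‖ = 1 → -w = p • z₁ + q • z₂ → 1 ≤ p + q := by
    intro p q w hp hq hw hwe
    rw [← hw, ← norm_neg, hwe]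
    refine (norm_add_le _ _).trans ?_
    rw [norm_smul, norm_smul, h₁, h₂, Real.norm_of_nonneg hp, Real.norm_of_nonneg hq]
    linarith
  have k1 := key hs0 ht0 h₃ hz
  have k2 := key (sub_nonneg.2 hs1) (sub_nonneg.2 ht1) h₄ hz'
  obtain rfl : t = 1 - s := by linarith
  rcases hs0.eq_or_lt with rfl | hs0
  · right; right; right
    rw [hz']; simp
  rcases hs1.eq_or_lt with rfl | hs1
  · right; right; left
    rw [hz]; simp
  obtain ⟨f, hf, hfz⟩ := supportFunctionals_nonempty (show ‖-z₃‖ = 1 by rwa [norm_neg])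
  have b1 := apply_le_one_of_norm_le_one hf.le h₁.le
  have b2 := apply_le_one_of_norm_le_one hf.le h₂.le
  have e3 : f z₃ = -1 := by rw [map_neg] at hfz; linarith
  rw [hz, map_add, map_smul, map_smul, smul_eq_mul, smul_eq_mul] at hfz
  have e1 : f z₁ = 1 := by nlinarith
  have e2 : f z₂ = 1 := by nlinarith
  have e4 : f z₄ = -1 := by
    have := congrArg f hsum
    simp only [map_add, map_zero] at this
    linarith
  exact Or.inl ⟨f, hf.le, by simp [e1, e2, e3, e4]⟩

end Plane

/-! ### Four unit vectors with sum zero -/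

section FourUnitVectors

variable {Y : Type*} [NormedAddCommGroup Y] [NormedSpace ℝ Y] {z₁ z₂ z₃ z₄ : Y}

theorem AlignedOrOpposite.swap_right (h : AlignedOrOpposite z₁ z₂ z₃ z₄) :
    AlignedOrOpposite z₁ z₂ z₄ z₃ := by
  rcases h with ⟨f, hf, h₁, h₂, h₃, h₄⟩ | h | h | h
  · exact Or.inl ⟨f, hf, h₁, h₂, h₄, h₃⟩
  · exact Or.inr (Or.inl h)
  · exact Or.inr (Or.inr (Or.inr h))
  · exact Or.inr (Or.inr (Or.inl h))

theorem AlignedOrOpposite.swap_middle (h : AlignedOrOpposite z₁ z₂ z₃ z₄) :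
    AlignedOrOpposite z₁ z₃ z₂ z₄ := by
  rcases h with ⟨f, hf, h₁, h₂, h₃, h₄⟩ | h | h | h
  · exact Or.inl ⟨f, hf, h₁, h₃, h₂, h₄⟩
  · exact Or.inr (Or.inr (Or.inl h))
  · exact Or.inr (Or.inl h)
  · exact Or.inr (Or.inr (Or.inr h))

theorem AlignedOrOpposite.swap_left (hsum : z₁ + z₂ + z₃ + z₄ = 0)
    (h : AlignedOrOpposite z₁ z₂ z₃ z₄) : AlignedOrOpposite z₂ z₁ z₃ z₄ := by
  rcases h with ⟨f, hf, h₁, h₂, h₃, h₄⟩ | rfl | rfl | rfl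
  · exact Or.inl ⟨f, hf, h₂, h₁, h₃, h₄⟩
  · exact Or.inr (Or.inl (by simp))
  · exact Or.inr (Or.inr (Or.inr (by rw [← sub_eq_zero, ← hsum]; module)))
  · exact Or.inr (Or.inr (Or.inl (by rw [← sub_eq_zero, ← hsum]; module)))

theorem alignedOrOpposite_of_eq (h₁ : ‖z₁‖ = 1) (h₃ : ‖z₃‖ = 1) (h₄ : ‖z₄‖ = 1)
    (hsum : z₁ + z₁ + z₃ + z₄ = 0) : AlignedOrOpposite z₁ z₁ z₃ z₄ := by
  obtain ⟨f, hf, hf1⟩ := supportFunctionals_nonempty h₁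
  have b3 := apply_le_one_of_norm_le_one hf.le (show ‖-z₃‖ ≤ 1 by rw [norm_neg, h₃])
  have b4 := apply_le_one_of_norm_le_one hf.le (show ‖-z₄‖ ≤ 1 by rw [norm_neg, h₄])
  have e := congrArg f hsum
  simp only [map_add, map_zero, map_neg] at e b3 b4
  have e3 : f z₃ = -1 := by linarith
  have e4 : f z₄ = -1 := by linarith
  exact Or.inl ⟨f, hf.le, by simp [hf1, e3, e4]⟩

/-- Four unit vectors of a normed plane with sum zero are aligned, or form two opposite pairs. -/
theorem alignedOrOpposite_of_add_eq_zero (hY : Module.finrank ℝ Y = 2) (h₁ : ‖z₁‖ = 1)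
    (h₂ : ‖z₂‖ = 1) (h₃ : ‖z₃‖ = 1) (h₄ : ‖z₄‖ = 1) (hsum : z₁ + z₂ + z₃ + z₄ = 0) :
    AlignedOrOpposite z₁ z₂ z₃ z₄ := by
  by_cases hli : LinearIndependent ℝ ![z₁, z₂]
  swap
  · rw [LinearIndependent.pair_iff' (by rintro rfl; simp at h₁)] at hli
    push Not at hli
    obtain ⟨c, rfl⟩ := hli
    rw [norm_smul, h₁, mul_one, Real.norm_eq_abs] at h₂
    rcases eq_or_eq_neg_of_abs_eq h₂ with rfl | rfl
    · rw [one_smul] at hsum ⊢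
      exact alignedOrOpposite_of_eq h₁ h₃ h₄ hsum
    · exact Or.inr (Or.inl (by simp))
  obtain ⟨a, b, hz₃⟩ := exists_eq_smul_add_smul hY hli z₃
  have hz₄ : z₄ = (-(1 + a)) • z₁ + (-(1 + b)) • z₂ := by
    rw [← sub_eq_zero, ← hsum, hz₃]; module
  -- In each claim `cij` the parallelogram spanned by `zᵢ, zⱼ` contains the negatives of the other
  -- two vectors. The conditions on `(a, b)` express this, and the six regions cover the plane.
  have c12 : a ∈ Set.Icc (-1 : ℝ) 0 → b ∈ Set.Icc (-1 : ℝ) 0 → AlignedOrOpposite z₁ z₂ z₃ z₄ := by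
    rintro ⟨ha, ha'⟩ ⟨hb, hb'⟩
    exact alignedOrOpposite_of_mem_parallelogram h₁ h₂ h₃ h₄ hsum (s := -a) (t := -b)
      ⟨by linarith, by linarith⟩ ⟨by linarith, by linarith⟩ (by rw [hz₃]; module)
  have c13 : b ≤ -1 → b ≤ a → a ≤ 0 → AlignedOrOpposite z₁ z₂ z₃ z₄ := by
    intro hb hba ha
    have hb0 : b < 0 := by linarith
    have hb1 := hb0.ne
    refine (alignedOrOpposite_of_mem_parallelogram h₁ h₃ h₂ h₄ (by rw [← hsum]; abel)
      (s := a / b) (t := -1 / b) ⟨div_nonneg_of_nonpos ha hb0.le, (div_le_one_of_neg hb0).2 hba⟩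
      ⟨div_nonneg_of_nonpos (by norm_num) hb0.le, (div_le_one_of_neg hb0).2 hb⟩ ?_).swap_middle
    rw [hz₃]
    match_scalars <;> field_simp <;> ring
  have c23 : a ≤ -1 → a ≤ b → b ≤ 0 → AlignedOrOpposite z₁ z₂ z₃ z₄ := by
    intro ha hab hb
    have ha0 : a < 0 := by linarith
    have ha1 := ha0.ne
    refine ((alignedOrOpposite_of_mem_parallelogram h₂ h₃ h₁ h₄ (by rw [← hsum]; abel)
      (s := b / a) (t := -1 / a) ⟨div_nonneg_of_nonpos hb ha0.le, (div_le_one_of_neg ha0).2 hab⟩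
      ⟨div_nonneg_of_nonpos (by norm_num) ha0.le, (div_le_one_of_neg ha0).2 ha⟩
      ?_).swap_middle).swap_left (by rw [← hsum]; abel)
    rw [hz₃]
    match_scalars <;> field_simp <;> ring
  have c14 : 0 ≤ b → -1 ≤ a → a ≤ b → AlignedOrOpposite z₁ z₂ z₃ z₄ := by
    intro hb ha hab
    have hb0 : 0 < 1 + b := by linarith
    refine ((alignedOrOpposite_of_mem_parallelogram h₁ h₄ h₂ h₃ (by rw [← hsum]; abel)
      (s := (1 + a) / (1 + b)) (t := 1 / (1 + b))
      ⟨div_nonneg (by linarith) hb0.le, (div_le_one hb0).2 (by linarith)⟩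
      ⟨div_nonneg zero_le_one hb0.le, (div_le_one hb0).2 (by linarith)⟩
      ?_).swap_middle).swap_right
    rw [hz₄]
    match_scalars <;> field_simp <;> ring
  have c24 : 0 ≤ a → -1 ≤ b → b ≤ a → AlignedOrOpposite z₁ z₂ z₃ z₄ := by
    intro ha hb hab
    have ha0 : 0 < 1 + a := by linarith
    refine (((alignedOrOpposite_of_mem_parallelogram h₂ h₄ h₁ h₃ (by rw [← hsum]; abel)
      (s := (1 + b) / (1 + a)) (t := 1 / (1 + a))
      ⟨div_nonneg (by linarith) ha0.le, (div_le_one ha0).2 (by linarith)⟩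
      ⟨div_nonneg zero_le_one ha0.le, (div_le_one ha0).2 (by linarith)⟩
      ?_).swap_middle).swap_right).swap_left (by rw [← hsum]; abel)
    rw [hz₄]
    match_scalars <;> field_simp <;> ring
  have c34 : b - a ≠ 0 → (1 + b) / (b - a) ∈ Set.Icc (0 : ℝ) 1 → b / (b - a) ∈ Set.Icc (0 : ℝ) 1 →
      AlignedOrOpposite z₁ z₂ z₃ z₄ := by
    intro h0 hs ht
    refine ((((alignedOrOpposite_of_mem_parallelogram h₃ h₄ h₁ h₂ (by rw [← hsum]; abel) hs ht
      ?_).swap_middle).swap_left (by rw [← hsum]; abel)).swap_right).swap_middle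
    rw [hz₃, hz₄]
    match_scalars <;> field_simp <;> ring
  rcases le_total 0 b with hb | hb
  · rcases le_total a (-1) with ha | ha
    · have h0 : 0 < b - a := by linarith
      exact c34 h0.ne' ⟨div_nonneg (by linarith) h0.le, (div_le_one h0).2 (by linarith)⟩
        ⟨div_nonneg hb h0.le, (div_le_one h0).2 (by linarith)⟩
    rcases le_total a b with hab | hab
    · exact c14 hb ha hab
    · exact c24 (by linarith) (by linarith) hab
  rcases le_total (-1) b with hb' | hb'
  · rcases le_total 0 a with ha | ha
    · exact c24 ha hb' (by linarith)
    rcases le_total (-1) a with ha' | ha'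
    · exact c12 ⟨ha', ha⟩ ⟨hb', hb⟩
    · exact c23 ha' (by linarith) hb
  rcases le_total 0 a with ha | ha
  · have h0 : b - a < 0 := by linarith
    exact c34 h0.ne ⟨div_nonneg_of_nonpos (by linarith) h0.le, (div_le_one_of_neg h0).2 (by linarith)⟩
      ⟨div_nonneg_of_nonpos hb h0.le, (div_le_one_of_neg h0).2 (by linarith)⟩
  rcases le_total b a with hab | hab
  · exact c13 hb' hab ha
  · exact c23 (by linarith) hab hb

/-- All four points lie on the line `f = 1`. With `z₁` at position 0 and `z₃` at 1, `z₂` is at `q`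
and `z₄` at `q - 1`. Unless `z₁` equals one of the other points, some point assumed nonsmooth falls
strictly between two others, hence inside a segment of the sphere, where points are smooth. -/
theorem not_isSmoothVector_of_add_eq_add (hY : Module.finrank ℝ Y = 2) {f : Y →L[ℝ] ℝ}
    (hf : ‖f‖ ≤ 1) (f₁ : f z₁ = 1) (f₂ : f z₂ = 1) (f₃ : f z₃ = 1)
    (f₄ : f z₄ = 1) (h₁ : ‖z₁‖ = 1) (h₂ : ‖z₂‖ = 1) (h₃ : ‖z₃‖ = 1) (h₄ : ‖z₄‖ = 1)
    (hsum : z₁ + z₂ = z₃ + z₄) (n₂ : ¬ IsSmoothVector z₂) (n₃ : ¬ IsSmoothVector z₃)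
    (n₄ : ¬ IsSmoothVector z₄) : ¬ IsSmoothVector z₁ := by
  rcases eq_or_ne z₁ z₃ with rfl | h13
  · exact n₃
  obtain ⟨p, q, hz₂⟩ := exists_eq_smul_add_smul hY
    (linearIndependent_pair_of_apply_eq_one f₁ f₃ h13) z₂
  have hpq : p + q = 1 := by simpa [f₁, f₂, f₃] using (congrArg f hz₂).symm
  obtain rfl : p = 1 - q := by linarith
  have hz₄ : z₄ = (2 - q) • z₁ + (q - 1) • z₃ := by
    rw [eq_sub_of_add_eq' hsum.symm, hz₂]; module
  rcases lt_trichotomy q 0 with hq | rfl | hq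
  · refine absurd (isSmoothVector_of_openSegment hY hf f₄ f₁ h₄ h₁ ?_ h₂
      ⟨q / (q - 1), 1 - q / (q - 1), div_pos_of_neg_of_neg hq (by linarith), ?_, by ring, ?_⟩) n₂
    · intro h
      have h0 : (q - 1) • (z₃ - z₁) = z₄ - z₁ := by rw [hz₄]; module
      rw [h, sub_self, smul_eq_zero, sub_eq_zero, sub_eq_zero] at h0
      rcases h0 with h0 | h0
      · linarith
      · exact h13 h0.symm
    · rw [sub_pos, div_lt_one_of_neg (by linarith)]; linarith
    · have : q - 1 ≠ 0 := by linarith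
      rw [hz₂, hz₄]
      match_scalars <;> field_simp <;> ring
  · simpa [hz₂] using n₂
  rcases lt_trichotomy q 1 with hq1 | rfl | hq1
  · exact absurd (isSmoothVector_of_openSegment hY hf f₁ f₃ h₁ h₃ h13 h₂
      ⟨1 - q, q, by linarith, hq, by ring, hz₂.symm⟩) n₂
  · convert n₄ using 2
    rw [hz₄]; module
  · refine absurd (isSmoothVector_of_openSegment hY hf f₁ f₂ h₁ h₂ ?_ h₃
      ⟨1 - 1 / q, 1 / q, ?_, by positivity, by ring, ?_⟩) n₃
    · intro h
      have h0 : q • (z₃ - z₁) = z₂ - z₁ := by rw [hz₂]; module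
      rw [← h, sub_self, smul_eq_zero, sub_eq_zero] at h0
      rcases h0 with h0 | h0
      · exact hq.ne' h0
      · exact h13 h0.symm
    · rw [sub_pos, div_lt_one hq]; exact hq1
    · rw [hz₂]
      match_scalars <;> field_simp <;> ring

/-- Among four unit vectors of a normed plane with sum zero, there is never exactly one smooth
vector. -/
theorem not_isSmoothVector_of_add_eq_zero (hY : Module.finrank ℝ Y = 2) (h₁ : ‖z₁‖ = 1)
    (h₂ : ‖z₂‖ = 1) (h₃ : ‖z₃‖ = 1) (h₄ : ‖z₄‖ = 1) (hsum : z₁ + z₂ + z₃ + z₄ = 0)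
    (n₂ : ¬ IsSmoothVector z₂) (n₃ : ¬ IsSmoothVector z₃) (n₄ : ¬ IsSmoothVector z₄) :
    ¬ IsSmoothVector z₁ := by
  have key : ∀ {u v w : Y} (f : Y →L[ℝ] ℝ), ‖f‖ ≤ 1 → f z₁ = 1 → f u = 1 → f v = -1 → f w = -1 →
      ‖u‖ = 1 → ‖v‖ = 1 → ‖w‖ = 1 → z₁ + u + v + w = 0 → ¬ IsSmoothVector u →
      ¬ IsSmoothVector v → ¬ IsSmoothVector w → ¬ IsSmoothVector z₁ := by
    intro u v w f hf f₁ fu fv fw hu hv hw hs nu nv nw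
    refine not_isSmoothVector_of_add_eq_add hY (z₃ := -v) (z₄ := -w) hf f₁ fu (by simp [fv])
      (by simp [fw]) h₁ hu (by rwa [norm_neg]) (by rwa [norm_neg]) ?_ nu
      (by rwa [isSmoothVector_neg]) (by rwa [isSmoothVector_neg])
    rw [← sub_eq_zero, ← hs]; abel
  have key' : ∀ {u v w : Y} (f : Y →L[ℝ] ℝ), ‖f‖ ≤ 1 → |f z₁| = 1 → f u = f z₁ → f v = -f z₁ →
      f w = -f z₁ → ‖u‖ = 1 → ‖v‖ = 1 → ‖w‖ = 1 → z₁ + u + v + w = 0 → ¬ IsSmoothVector u →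
      ¬ IsSmoothVector v → ¬ IsSmoothVector w → ¬ IsSmoothVector z₁ := by
    intro u v w f hf f₁ fu fv fw
    rcases eq_or_eq_neg_of_abs_eq f₁ with e | e
    · exact key f hf e (by rw [fu, e]) (by rw [fv, e]) (by rw [fw, e])
    · exact key (-f) (by rwa [norm_neg]) (by simp [e]) (by simp [fu, e]) (by simp [fv, e])
        (by simp [fw, e])
  rcases alignedOrOpposite_of_add_eq_zero hY h₁ h₂ h₃ h₄ hsum with
    ⟨f, hf, f₁, f₂, f₃, f₄⟩ | h | h | h
  · have fs := congrArg f hsum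
    simp only [map_add, map_zero] at fs
    -- Four values `±1` with sum zero: exactly one other vector shares the value of `z₁`.
    have a₂ := abs_eq_abs.1 (f₂.trans f₁.symm)
    have a₃ := abs_eq_abs.1 (f₃.trans f₁.symm)
    have a₄ := abs_eq_abs.1 (f₄.trans f₁.symm)
    have h0 : f z₁ ≠ 0 := by intro h; simp [h] at f₁
    rcases a₂ with a₂ | a₂
    · refine key' f hf f₁ a₂ ?_ ?_ h₂ h₃ h₄ hsum n₂ n₃ n₄ <;> grind
    rcases a₃ with a₃ | a₃
    · refine key' f hf f₁ a₃ a₂ ?_ h₃ h₂ h₄ (by rw [← hsum]; abel) n₃ n₂ n₄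
      grind
    · refine key' f hf f₁ ?_ a₂ a₃ h₄ h₂ h₃ (by rw [← hsum]; abel) n₄ n₂ n₃
      grind
  all_goals rw [h, isSmoothVector_neg]; assumption

end FourUnitVectors

/-! ### Supporting functionals of an operator on the cube -/

section VertexFunctionals

/-- One vertex of the cube from each antipodal pair, with signs chosen so that the sum is zero. -/
def alternatingVertex : Fin 4 → (Fin 3 → ℝ) :=
  ![![1, 1, 1], ![1, -1, -1], ![-1, -1, 1], ![-1, 1, -1]]

theorem alternatingVertex_eq_or_eq_neg (i : Fin 4) :
    alternatingVertex i = cubeVertex i ∨ alternatingVertex i = -cubeVertex i := by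
  fin_cases i <;> simp [alternatingVertex, cubeVertex]

theorem norm_alternatingVertex (i : Fin 4) : ‖alternatingVertex i‖ = 1 := by
  have h : ∀ j, ‖alternatingVertex i j‖ = 1 := by
    intro j
    fin_cases i <;> fin_cases j <;> simp [alternatingVertex]
  refine le_antisymm ((pi_norm_le_iff_of_nonneg zero_le_one).2 fun j => (h j).le) ?_
  rw [← h 0]
  exact norm_le_pi_norm _ 0

theorem cubeVertex_injective : Function.Injective cubeVertex := by
  intro i j h
  have h0 := congrFun h 0
  have h1 := congrFun h 1
  fin_cases i <;> fin_cases j <;> first | rfl | (exfalso; revert h0 h1; norm_num [cubeVertex])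

theorem closedBall_subset_convexHull_pi :
    Metric.closedBall (0 : Fin 3 → ℝ) 1 ⊆
      convexHull ℝ (Set.univ.pi fun _ : Fin 3 => ({-1, 1} : Set ℝ)) := by
  intro v hv
  rw [convexHull_pi]
  intro j _
  rw [convexHull_pair, segment_eq_Icc (by norm_num)]
  exact abs_le.1 ((norm_le_pi_norm v j).trans (mem_closedBall_zero_iff.1 hv))

theorem eq_alternatingVertex_or_eq_neg {v : Fin 3 → ℝ}
    (hv : v ∈ Set.univ.pi fun _ : Fin 3 => ({-1, 1} : Set ℝ)) :
    ∃ i, v = alternatingVertex i ∨ v = -alternatingVertex i := by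
  have hv' : v = ![v 0, v 1, v 2] := by
    ext j
    fin_cases j <;> rfl
  have h0 := hv 0 trivial
  have h1 := hv 1 trivial
  have h2 := hv 2 trivial
  simp only [Set.mem_insert_iff, Set.mem_singleton_iff] at h0 h1 h2
  rw [hv']
  rcases h0 with h0 | h0 <;> rcases h1 with h1 | h1 <;> rcases h2 with h2 | h2 <;>
    rw [h0, h1, h2]
  · exact ⟨0, by simp [alternatingVertex]⟩
  · exact ⟨2, by simp [alternatingVertex]⟩
  · exact ⟨3, by simp [alternatingVertex]⟩
  · exact ⟨1, by simp [alternatingVertex]⟩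
  · exact ⟨1, by simp [alternatingVertex]⟩
  · exact ⟨3, by simp [alternatingVertex]⟩
  · exact ⟨2, by simp [alternatingVertex]⟩
  · exact ⟨0, by simp [alternatingVertex]⟩

variable {Y : Type*} [NormedAddCommGroup Y] [NormedSpace ℝ Y]

/-- The operator norm on `ℓ_∞³` is the maximum of the norms at the vertices. -/
theorem opNorm_le_of_alternatingVertex {A : (Fin 3 → ℝ) →L[ℝ] Y} {C : ℝ}
    (h : ∀ i, ‖A (alternatingVertex i)‖ ≤ C) : ‖A‖ ≤ C := by
  refine A.opNorm_le_of_unit_norm ((norm_nonneg _).trans (h 0)) fun v hv => ?_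
  have hsub : convexHull ℝ (Set.univ.pi fun _ : Fin 3 => ({-1, 1} : Set ℝ)) ⊆
      A ⁻¹' Metric.closedBall 0 C := by
    refine convexHull_min ?_ ((convex_closedBall 0 C).is_linear_preimage A.isLinear)
    intro w hw
    rw [Set.mem_preimage, mem_closedBall_zero_iff]
    obtain ⟨i, rfl | rfl⟩ := eq_alternatingVertex_or_eq_neg hw
    · exact h i
    · rw [map_neg, norm_neg]
      exact h i
  exact mem_closedBall_zero_iff.1
    (hsub (closedBall_subset_convexHull_pi (mem_closedBall_zero_iff.2 hv.le)))

/-- Evaluation at the four vertices, an isometric embedding of the operator space. -/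
noncomputable def vertexEval (Y : Type*) [NormedAddCommGroup Y] [NormedSpace ℝ Y] :
    ((Fin 3 → ℝ) →L[ℝ] Y) →ₗᵢ[ℝ] (Fin 4 → Y) where
  toFun A i := A (alternatingVertex i)
  map_add' A B := rfl
  map_smul' c A := rfl
  norm_map' A := by
    refine le_antisymm ((pi_norm_le_iff_of_nonneg (norm_nonneg _)).2 fun i => ?_)
      (opNorm_le_of_alternatingVertex fun i => ?_)
    · simpa [norm_alternatingVertex] using A.le_opNorm (alternatingVertex i)
    · exact norm_le_pi_norm (fun i => A (alternatingVertex i)) i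

theorem vertexEval_apply (A : (Fin 3 → ℝ) →L[ℝ] Y) (i : Fin 4) :
    vertexEval Y A i = A (alternatingVertex i) :=
  rfl

/-- The functional `A ↦ g (A v)` on the operator space, as a linear map in `g`. -/
noncomputable def evalFunctional (v : Fin 3 → ℝ) :
    (Y →L[ℝ] ℝ) →ₗ[ℝ] (((Fin 3 → ℝ) →L[ℝ] Y) →L[ℝ] ℝ) where
  toFun g := g.comp (ContinuousLinearMap.apply ℝ Y v)
  map_add' _ _ := rfl
  map_smul' _ _ := rfl

theorem evalFunctional_apply (v : Fin 3 → ℝ) (g : Y →L[ℝ] ℝ) (A : (Fin 3 → ℝ) →L[ℝ] Y) :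
    evalFunctional v g A = g (A v) :=
  rfl

/-- Stated for unnormalised functionals, zero included, since a component of a supporting functional
on `Y⁴` may have any norm up to 1 and may vanish. -/
theorem mem_supportSpan_of_norm_le_apply {x : Y} {f : Y →L[ℝ] ℝ} (hx : ‖x‖ = 1)
    (hf : ‖f‖ ≤ f x) : f ∈ supportSpan x := by
  rcases eq_or_ne f 0 with rfl | h0
  · exact zero_mem _
  have hn : ‖f‖ ≠ 0 := norm_ne_zero_iff.2 h0
  have hfx : f x = ‖f‖ := by
    refine le_antisymm ?_ hf
    simpa [hx] using (le_abs_self _).trans (f.le_opNorm x)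
  have hmem : ‖f‖⁻¹ • f ∈ supportFunctionals x := by
    refine ⟨?_, ?_⟩
    · rw [norm_smul, norm_inv, norm_norm, inv_mul_cancel₀ hn]
    · rw [smul_apply, hfx, smul_eq_mul, inv_mul_cancel₀ hn]
  rw [← smul_inv_smul₀ hn f]
  exact Submodule.smul_mem _ _ (Submodule.subset_span hmem)

/-- A supporting functional of `T` is a sum of functionals carried by the vertices. -/
theorem exists_eq_sum_evalFunctional {T : (Fin 3 → ℝ) →L[ℝ] Y}
    (hT : ∀ i, ‖T (alternatingVertex i)‖ = 1) {F : ((Fin 3 → ℝ) →L[ℝ] Y) →L[ℝ] ℝ}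
    (hF : F ∈ supportFunctionals T) :
    ∃ g : Fin 4 → (Y →L[ℝ] ℝ), (∀ i, g i ∈ supportSpan (T (alternatingVertex i))) ∧
      F = ∑ i, evalFunctional (alternatingVertex i) (g i) := by
  -- `F` is carried to the range of the isometric embedding and extended to `Y⁴` without increasing
  -- the norm.
  let e := (vertexEval Y).equivRange
  let F' : LinearMap.range (vertexEval Y).toLinearMap →L[ℝ] ℝ :=
    F.comp (e.symm.toContinuousLinearEquiv : _ →L[ℝ] _)
  have hF' : ‖F'‖ ≤ 1 := by
    refine F'.opNorm_le_bound zero_le_one fun p => ?_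
    have h := F.le_opNorm (e.symm p)
    rwa [hF.1, e.symm.norm_map] at h
  obtain ⟨G, hG, hGn⟩ := exists_extension_norm_eq _ F'
  have hGF : ∀ A, G (vertexEval Y A) = F A := by
    intro A
    have h := hG (e A)
    rw [show F' (e A) = F A from congrArg F (e.symm_apply_apply A)] at h
    exact h
  have hG1 : ‖G‖ ≤ 1 := hGn.trans_le hF'
  have hGT : G (vertexEval Y T) = 1 := (hGF T).trans hF.2
  let g : Fin 4 → (Y →L[ℝ] ℝ) := fun i => G.comp (ContinuousLinearMap.single ℝ (fun _ => Y) i)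
  have hg : ∀ i y, g i y = G (Pi.single i y) := fun i y => rfl
  -- Replacing one coordinate of the tuple of `T` by a vector of the unit ball keeps the maximum
  -- norm at most 1, so `G` cannot exceed 1 there. Each component thus attains its norm at the
  -- corresponding image vertex.
  have hle : ∀ i y, ‖y‖ ≤ 1 → g i y ≤ g i (T (alternatingVertex i)) := by
    intro i y hy
    have h1 : ‖vertexEval Y T + Pi.single i (y - T (alternatingVertex i))‖ ≤ 1 := by
      refine (pi_norm_le_iff_of_nonneg zero_le_one).2 fun j => ?_
      rcases eq_or_ne j i with rfl | hj
      · simpa [vertexEval_apply] using hy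
      · simpa [vertexEval_apply, hj] using (hT j).le
    have h2 := apply_le_one_of_norm_le_one hG1 h1
    rw [map_add, hGT, ← hg, map_sub] at h2
    linarith
  refine ⟨g, fun i => mem_supportSpan_of_norm_le_apply (hT i) ?_, ?_⟩
  · refine (g i).opNorm_le_of_unit_norm ?_ fun y hy => abs_le'.2 ⟨hle i y hy.le, ?_⟩
    · simpa using hle i 0 (by simp)
    · simpa using hle i (-y) (by rw [norm_neg, hy])
  · ext A
    rw [← hGF, ← Finset.univ_sum_single (vertexEval Y A), map_sum, sum_apply]
    rfl

theorem evalFunctional_mem_supportFunctionals {T : (Fin 3 → ℝ) →L[ℝ] Y} (hT1 : ‖T‖ = 1)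
    {v : Fin 3 → ℝ} (hv : ‖v‖ = 1) {g : Y →L[ℝ] ℝ} (hg : g ∈ supportFunctionals (T v)) :
    evalFunctional v g ∈ supportFunctionals T := by
  refine mem_supportFunctionals_of_norm_le_one ?_ hT1.le hg.2
  refine (evalFunctional v g).opNorm_le_bound zero_le_one fun A => ?_
  have h1 := g.le_opNorm (A v)
  have h2 := A.le_opNorm v
  rw [hg.1] at h1
  rw [hv, mul_one] at h2
  rw [evalFunctional_apply]
  linarith

theorem mem_supportSpan_iff_exists_eq_sum {T : (Fin 3 → ℝ) →L[ℝ] Y} (hT1 : ‖T‖ = 1)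
    (hT : ∀ i, ‖T (alternatingVertex i)‖ = 1) (F : ((Fin 3 → ℝ) →L[ℝ] Y) →L[ℝ] ℝ) :
    F ∈ supportSpan T ↔ ∃ g : ∀ i, supportSpan (T (alternatingVertex i)),
      ∑ i, evalFunctional (alternatingVertex i) (g i : Y →L[ℝ] ℝ) = F := by
  constructor
  · intro hF
    induction hF using Submodule.span_induction with
    | mem F hF =>
      obtain ⟨g, hg, rfl⟩ := exists_eq_sum_evalFunctional hT hF
      exact ⟨fun i => ⟨g i, hg i⟩, rfl⟩
    | zero => exact ⟨0, by simp⟩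
    | add F G _ _ hF hG =>
      obtain ⟨f, rfl⟩ := hF
      obtain ⟨g, rfl⟩ := hG
      exact ⟨f + g, by simp [Finset.sum_add_distrib]⟩
    | smul c F _ hF =>
      obtain ⟨f, rfl⟩ := hF
      exact ⟨c • f, by simp [Finset.smul_sum]⟩
  · rintro ⟨g, rfl⟩
    refine Submodule.sum_mem _ fun i _ => ?_
    have h : supportSpan (T (alternatingVertex i)) ≤
        (supportSpan T).comap (evalFunctional (alternatingVertex i)) :=
      Submodule.span_le.2 fun f hf => Submodule.subset_span
        (evalFunctional_mem_supportFunctionals hT1 (norm_alternatingVertex i) hf)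
    exact h (g i).2

/-- Dual form of the fact that `∑ v i = 0` is the only linear relation among the vertices, up to
scaling. -/
theorem sum_evalFunctional_eq_zero_iff {g : Fin 4 → (Y →L[ℝ] ℝ)} :
    ∑ i, evalFunctional (alternatingVertex i) (g i) = 0 ↔ ∀ i, g i = g 0 := by
  constructor
  · intro h
    -- Tested on the rank-one operators `v ↦ v k • y`.
    have key : ∀ (k : Fin 3) (y : Y), ∑ i, alternatingVertex i k * g i y = 0 := by
      intro k y
      have h1 := congrArg (fun F : ((Fin 3 → ℝ) →L[ℝ] Y) →L[ℝ] ℝ =>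
        F ((ContinuousLinearMap.proj (R := ℝ) (φ := fun _ : Fin 3 => ℝ) k).smulRight y)) h
      simpa [evalFunctional_apply] using h1
    have key' : ∀ y, g 1 y = g 0 y ∧ g 2 y = g 0 y ∧ g 3 y = g 0 y := by
      intro y
      have h0 := key 0 y
      have h1 := key 1 y
      have h2 := key 2 y
      simp only [Fin.sum_univ_four, alternatingVertex, Matrix.cons_val] at h0 h1 h2
      exact ⟨by linarith, by linarith, by linarith⟩
    intro i
    ext y
    obtain ⟨h1, h2, h3⟩ := key' y
    fin_cases i
    exacts [rfl, h1, h2, h3]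
  · intro h
    ext A
    have hsum : ∑ i, alternatingVertex i = 0 := by
      ext k
      fin_cases k <;> simp [Fin.sum_univ_four, alternatingVertex]
    have h2 : ∑ i, g 0 (A (alternatingVertex i)) = 0 := by
      rw [← map_sum, ← map_sum, hsum, map_zero, map_zero]
    simpa [evalFunctional_apply, h] using h2

/-- If the only relations between the images of the maps `φ i` are the diagonal ones, then the
dimension of `∑ φ i (V i)` is `∑ dim (V i) - dim (⨅ V i)`. -/
theorem finrank_add_finrank_iInf_of_sum_eq_zero_iff {W E : Type*} [AddCommGroup W] [Module ℝ W]
    [FiniteDimensional ℝ W] [AddCommGroup E] [Module ℝ E] {n : ℕ} (φ : Fin (n + 1) → W →ₗ[ℝ] E)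
    (hφ : ∀ g : Fin (n + 1) → W, ∑ i, φ i (g i) = 0 ↔ ∀ i, g i = g 0)
    (V : Fin (n + 1) → Submodule ℝ W) (P : Submodule ℝ E)
    (hP : ∀ F, F ∈ P ↔ ∃ g : ∀ i, V i, ∑ i, φ i (g i) = F) :
    Module.finrank ℝ P + Module.finrank ℝ (⨅ i, V i : Submodule ℝ W) =
      ∑ i, Module.finrank ℝ (V i) := by
  let L : (∀ i, V i) →ₗ[ℝ] E := ∑ i, φ i ∘ₗ (V i).subtype ∘ₗ LinearMap.proj i
  have hL : ∀ g, L g = ∑ i, φ i (g i) := fun g => by simp [L]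
  -- The kernel of `L` is the diagonal copy of the intersection; rank–nullity then gives the
  -- formula.
  let D : (⨅ i, V i : Submodule ℝ W) →ₗ[ℝ] (∀ i, V i) :=
    LinearMap.pi fun i => Submodule.inclusion (iInf_le V i)
  have hD : Function.Injective D := fun a b h =>
    Subtype.ext (congrArg (fun g : ∀ i, V i => (g 0 : W)) h)
  have hker : LinearMap.ker L = LinearMap.range D := by
    ext g
    rw [LinearMap.mem_ker, hL, hφ (fun i => g i)]
    constructor
    · intro h
      refine ⟨⟨g 0, (Submodule.mem_iInf _).2 fun i => ?_⟩, ?_⟩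
      · rw [← h i]
        exact (g i).2
      · ext1 i
        exact Subtype.ext (h i).symm
    · rintro ⟨a, rfl⟩ i
      rfl
  have hrange : LinearMap.range L = P := by
    ext F
    simp only [LinearMap.mem_range, hP, hL]
  rw [← LinearMap.finrank_range_of_inj hD, ← hker, ← hrange,
    LinearMap.finrank_range_add_finrank_ker, Module.finrank_pi_fintype]

set_option maxHeartbeats 1600000 in
theorem finrank_supportSpan_add_finrank_iInf [FiniteDimensional ℝ Y]
    {T : (Fin 3 → ℝ) →L[ℝ] Y} (hT1 : ‖T‖ = 1) (hT : ∀ i, ‖T (alternatingVertex i)‖ = 1) :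
    Module.finrank ℝ (supportSpan T) +
      Module.finrank ℝ (⨅ i, supportSpan (T (alternatingVertex i)) : Submodule ℝ (Y →L[ℝ] ℝ)) =
      ∑ i, Module.finrank ℝ (supportSpan (T (alternatingVertex i))) := by
  have h := finrank_add_finrank_iInf_of_sum_eq_zero_iff (W := Y →L[ℝ] ℝ)
    (E := ((Fin 3 → ℝ) →L[ℝ] Y) →L[ℝ] ℝ)
    (fun i => evalFunctional (alternatingVertex i)) (fun _ => sum_evalFunctional_eq_zero_iff)
    (fun i => supportSpan (T (alternatingVertex i))) (supportSpan T)
  exact h (mem_supportSpan_iff_exists_eq_sum hT1 hT)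

end VertexFunctionals

/-! ### Dimensions of the spans and of their intersection -/

section Counting

variable {Y : Type*} [NormedAddCommGroup Y] [NormedSpace ℝ Y]

/-- Opposite vectors share both smoothness and span. The nonsmooth `z k` rules out its whole pair,
so `z i` and `z j` belong to the other one. -/
theorem supportSpan_eq_of_opposite_pairs {z : Fin 4 → Y} {a b c d i j k : Fin 4}
    (hcover : ∀ l, l = a ∨ l = b ∨ l = c ∨ l = d) (hab : z a = -z b) (hcd : z c = -z d)
    (hi : IsSmoothVector (z i)) (hj : IsSmoothVector (z j)) (hk : ¬ IsSmoothVector (z k)) :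
    supportSpan (z i) = supportSpan (z j) := by
  have e₁ : supportSpan (z a) = supportSpan (z b) := by rw [hab, supportSpan_neg]
  have e₂ : supportSpan (z c) = supportSpan (z d) := by rw [hcd, supportSpan_neg]
  have s₁ : IsSmoothVector (z a) ↔ IsSmoothVector (z b) := by rw [hab, isSmoothVector_neg]
  have s₂ : IsSmoothVector (z c) ↔ IsSmoothVector (z d) := by rw [hcd, isSmoothVector_neg]
  have ci := hcover i
  have cj := hcover j
  have ck := hcover k
  clear hab hcd hcover
  grind

/-- If four unit vectors of a normed plane have sum zero and are not all smooth, then the smooth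
ones have the same supporting functionals up to sign. -/
theorem supportSpan_eq_of_sum_eq_zero (hY : Module.finrank ℝ Y = 2) {z : Fin 4 → Y}
    (hz : ∀ i, ‖z i‖ = 1) (hsum : ∑ i, z i = 0) {i j k : Fin 4}
    (hi : IsSmoothVector (z i)) (hj : IsSmoothVector (z j)) (hk : ¬ IsSmoothVector (z k)) :
    supportSpan (z i) = supportSpan (z j) := by
  rw [Fin.sum_univ_four] at hsum
  rcases alignedOrOpposite_of_add_eq_zero hY (hz 0) (hz 1) (hz 2) (hz 3) hsum with
    ⟨f, hf, h0, h1, h2, h3⟩ | h | h | h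
  · have hall : ∀ l, |f (z l)| = 1 := by
      intro l
      fin_cases l
      exacts [h0, h1, h2, h3]
    rw [hi.supportSpan_eq_of_abs_apply_eq_one hf (hall i),
      hj.supportSpan_eq_of_abs_apply_eq_one hf (hall j)]
  · exact supportSpan_eq_of_opposite_pairs (a := 0) (b := 1) (c := 2) (d := 3) (by decide) h
      (by rw [← sub_eq_zero, ← hsum, h]; abel) hi hj hk
  · exact supportSpan_eq_of_opposite_pairs (a := 0) (b := 2) (c := 1) (d := 3) (by decide) h
      (by rw [← sub_eq_zero, ← hsum, h]; abel) hi hj hk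
  · exact supportSpan_eq_of_opposite_pairs (a := 0) (b := 3) (c := 1) (d := 2) (by decide) h
      (by rw [← sub_eq_zero, ← hsum, h]; abel) hi hj hk

theorem ncard_isSmoothVector_ne_one (hY : Module.finrank ℝ Y = 2) {z : Fin 4 → Y}
    (hz : ∀ i, ‖z i‖ = 1) (hsum : ∑ i, z i = 0) : {i | IsSmoothVector (z i)}.ncard ≠ 1 := by
  intro h
  obtain ⟨i, hi⟩ := Set.ncard_eq_one.1 h
  have hs : IsSmoothVector (z i) := by
    have : i ∈ {i | IsSmoothVector (z i)} := by rw [hi]; rfl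
    exact this
  have hns : ∀ j, j ≠ i → ¬ IsSmoothVector (z j) := by
    intro j hj hjs
    have : j ∈ {i | IsSmoothVector (z i)} := hjs
    rw [hi] at this
    exact hj this
  rw [Fin.sum_univ_four] at hsum
  revert hs
  rcases (by decide : ∀ i : Fin 4, i = 0 ∨ i = 1 ∨ i = 2 ∨ i = 3) i with rfl | rfl | rfl | rfl
  · exact not_isSmoothVector_of_add_eq_zero hY (hz 0) (hz 1) (hz 2) (hz 3) hsum
      (hns 1 (by decide)) (hns 2 (by decide)) (hns 3 (by decide))
  · exact not_isSmoothVector_of_add_eq_zero hY (hz 1) (hz 0) (hz 2) (hz 3)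
      (by rw [← hsum]; abel) (hns 0 (by decide)) (hns 2 (by decide)) (hns 3 (by decide))
  · exact not_isSmoothVector_of_add_eq_zero hY (hz 2) (hz 0) (hz 1) (hz 3)
      (by rw [← hsum]; abel) (hns 0 (by decide)) (hns 1 (by decide)) (hns 3 (by decide))
  · exact not_isSmoothVector_of_add_eq_zero hY (hz 3) (hz 0) (hz 1) (hz 2)
      (by rw [← hsum]; abel) (hns 0 (by decide)) (hns 1 (by decide)) (hns 2 (by decide))

/-- Every index contributes 2: `1 + 1` if smooth, `2 + 0` if not. -/
theorem sum_finrank_supportSpan_add_ncard (hY : Module.finrank ℝ Y = 2) {z : Fin 4 → Y}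
    (hz : ∀ i, ‖z i‖ = 1) :
    ∑ i, Module.finrank ℝ (supportSpan (z i)) + {i | IsSmoothVector (z i)}.ncard = 8 := by
  classical
  have : FiniteDimensional ℝ Y := .of_finrank_pos (by omega)
  have hc : {i | IsSmoothVector (z i)}.ncard = ∑ i, if IsSmoothVector (z i) then 1 else 0 := by
    rw [Set.ncard_eq_toFinset_card', Set.toFinset_ofPred, Finset.card_filter]
  rw [hc, ← Finset.sum_add_distrib]
  have hterm : ∀ i, Module.finrank ℝ (supportSpan (z i)) +
      (if IsSmoothVector (z i) then 1 else 0) = 2 := by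
    intro i
    split_ifs with h
    · rw [h.finrank_supportSpan]
    · rw [supportSpan_eq_top_of_not_isSmoothVector hY (hz i) h, finrank_top,
        finrank_continuousDual, hY]
  simp [hterm]

/-- Nonsmooth vectors have the full dual as span and do not affect the intersection. -/
theorem iInf_supportSpan_eq (hY : Module.finrank ℝ Y = 2) {z : Fin 4 → Y}
    (hz : ∀ i, ‖z i‖ = 1) {i : Fin 4}
    (h : ∀ j, IsSmoothVector (z j) → supportSpan (z j) = supportSpan (z i)) :
    ⨅ j, supportSpan (z j) = supportSpan (z i) := by
  refine le_antisymm (iInf_le _ i) (le_iInf fun j => ?_)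
  by_cases hj : IsSmoothVector (z j)
  · rw [h j hj]
  · rw [supportSpan_eq_top_of_not_isSmoothVector hY (hz j) hj]
    exact le_top

theorem finrank_iInf_supportSpan_eq_zero [FiniteDimensional ℝ Y] {z : Fin 4 → Y}
    (hz : ∀ i, IsSmoothVector (z i)) {i j : Fin 4} (hij : supportSpan (z i) ≠ supportSpan (z j)) :
    Module.finrank ℝ (⨅ l, supportSpan (z l) : Submodule ℝ (Y →L[ℝ] ℝ)) = 0 := by
  have hle := fun l => Submodule.finrank_mono (iInf_le (fun l => supportSpan (z l)) l)
  by_contra h0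
  have heq : ∀ l, ⨅ l, supportSpan (z l) = supportSpan (z l) := by
    intro l
    refine Submodule.eq_of_le_of_finrank_eq (iInf_le _ l) ?_
    have := hle l
    rw [(hz l).finrank_supportSpan] at this ⊢
    omega
  exact hij ((heq i).symm.trans (heq j))

theorem supportSpan_eq_of_finrank_range_eq_one {X : Type*} [NormedAddCommGroup X] [NormedSpace ℝ X]
    {T : X →L[ℝ] Y} (hT : Module.finrank ℝ (LinearMap.range (T : X →ₗ[ℝ] Y)) = 1) {x y : X}
    (hx : ‖T x‖ = 1) (hy : ‖T y‖ = 1) : supportSpan (T x) = supportSpan (T y) := by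
  let v : LinearMap.range (T : X →ₗ[ℝ] Y) := ⟨T x, x, rfl⟩
  have hv : v ≠ 0 := by
    intro h
    have h' : T x = 0 := congrArg Subtype.val h
    simp [h'] at hx
  obtain ⟨c, hc⟩ := (finrank_eq_one_iff_of_nonzero' v hv).1 hT ⟨T y, y, rfl⟩
  have hc' : c • T x = T y := congrArg Subtype.val hc
  rw [← hc', norm_smul, hx, mul_one, Real.norm_eq_abs] at hy
  rw [← hc']
  rcases eq_or_eq_neg_of_abs_eq hy with rfl | rfl
  · rw [one_smul]
  · rw [neg_smul, one_smul, supportSpan_neg]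

end Counting

/-! ### The cases of the theorem -/

theorem mainTheorem5 {Y : Type*} [NormedAddCommGroup Y] [NormedSpace ℝ Y]
    (hY : Module.finrank ℝ Y = 2)
    (T : (Fin 3 → ℝ) →L[ℝ] Y) (hT : ‖T‖ = 1)
    (hM : normAttainmentSet T ∩ Set.extremePoints ℝ (Metric.closedBall (0 : Fin 3 → ℝ) 1) =
      {p | ∃ i : Fin 4, p = cubeVertex i ∨ p = -cubeVertex i}) :
    ((smoothImageVertices T).ncard = 4 →
      ((Module.finrank ℝ (LinearMap.range (T : (Fin 3 → ℝ) →ₗ[ℝ] Y)) = 1 ∨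
          ∀ i j : Fin 4, i ≠ j →
            OnCommonSphereSegment (T (cubeVertex i)) (T (cubeVertex j)) ∨
            OnCommonSphereSegment (T (cubeVertex i)) (-T (cubeVertex j))) →
        IsKSmooth 3 T) ∧
      (¬ (Module.finrank ℝ (LinearMap.range (T : (Fin 3 → ℝ) →ₗ[ℝ] Y)) = 1 ∨
          ∀ i j : Fin 4, i ≠ j →
            OnCommonSphereSegment (T (cubeVertex i)) (T (cubeVertex j)) ∨
            OnCommonSphereSegment (T (cubeVertex i)) (-T (cubeVertex j))) →
        IsKSmooth 4 T)) ∧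
    ((smoothImageVertices T).ncard = 3 → IsKSmooth 4 T) ∧
    ((smoothImageVertices T).ncard = 2 → IsKSmooth 5 T) ∧
    ((smoothImageVertices T).ncard < 2 → smoothImageVertices T = ∅ ∧ IsKSmooth 6 T) := by
  have : FiniteDimensional ℝ Y := .of_finrank_pos (by omega)
  have hc : ∀ i, ‖T (cubeVertex i)‖ = 1 := by
    intro i
    have hi : cubeVertex i ∈ {p | ∃ i : Fin 4, p = cubeVertex i ∨ p = -cubeVertex i} :=
      ⟨i, Or.inl rfl⟩
    rw [← hM] at hi
    exact hi.1.2.trans hT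
  -- Passing to the sign-adjusted vertices changes neither smoothness nor spans, and makes the
  -- images sum to zero.
  set z : Fin 4 → Y := fun i => T (alternatingVertex i) with hz_def
  have hzc : ∀ i, z i = T (cubeVertex i) ∨ z i = -T (cubeVertex i) := by
    intro i
    rcases alternatingVertex_eq_or_eq_neg i with h | h <;> simp [hz_def, h]
  have hz : ∀ i, ‖z i‖ = 1 := by
    intro i
    rcases hzc i with h | h <;> simp [h, hc]
  have hspan : ∀ i, supportSpan (T (cubeVertex i)) = supportSpan (z i) := by
    intro i
    rcases hzc i with h | h <;> simp [h, supportSpan_neg]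
  have hsmooth : ∀ i, IsSmoothVector (T (cubeVertex i)) ↔ IsSmoothVector (z i) := by
    intro i
    rcases hzc i with h | h <;> simp [h, isSmoothVector_neg]
  have hsum : ∑ i, z i = 0 := by
    have h : ∑ i, alternatingVertex i = 0 := by
      ext k
      fin_cases k <;> simp [Fin.sum_univ_four, alternatingVertex]
    rw [← map_sum, h, map_zero]
  have himage : smoothImageVertices T = cubeVertex '' {i | IsSmoothVector (z i)} := by
    ext p
    simp only [smoothImageVertices, Set.mem_ofPred_eq, Set.mem_image, hsmooth]
    exact exists_congr fun i => ⟨fun h => ⟨h.2, h.1.symm⟩, fun h => ⟨h.2.symm, h.1⟩⟩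
  have hk : ∀ k, Module.finrank ℝ (supportSpan T) = k → IsKSmooth k T := by
    rintro k rfl
    exact ⟨hT, (Module.finrank_eq_rank ℝ (supportSpan T)).symm⟩
  have hdim := finrank_supportSpan_add_finrank_iInf hT hz
  have hcount := sum_finrank_supportSpan_add_ncard hY hz
  have hne := ncard_isSmoothVector_ne_one hY hz hsum
  rw [himage, Set.ncard_image_of_injective _ cubeVertex_injective, Set.image_eq_empty]
  set n := {i | IsSmoothVector (z i)}.ncard with hn
  -- When the smooth vectors share one line, the intersection is that line, which accounts for the
  -- summand 1.
  have hline : ∀ i, IsSmoothVector (z i) →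
      (∀ j, IsSmoothVector (z j) → supportSpan (z j) = supportSpan (z i)) →
      Module.finrank ℝ (supportSpan T) + 1 + n = 8 := by
    intro i hi h
    rw [← hcount, ← hdim, iInf_supportSpan_eq hY hz h, hi.finrank_supportSpan]
  have hmixed : 0 < n → n < 4 → Module.finrank ℝ (supportSpan T) + 1 + n = 8 := by
    intro hpos hlt
    obtain ⟨i, hi⟩ := (Set.ncard_pos).1 hpos
    obtain ⟨k, hk⟩ : ∃ k, ¬ IsSmoothVector (z k) := by
      by_contra! hall
      rw [hn, Set.eq_univ_of_forall (s := {i | IsSmoothVector (z i)}) hall, Set.ncard_univ,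
        Nat.card_eq_fintype_card, Fintype.card_fin] at hlt
      exact lt_irrefl _ hlt
    exact hline i hi fun j hj => supportSpan_eq_of_sum_eq_zero hY hz hsum hj hi hk
  refine ⟨fun h4 => ?_, fun h3 => hk _ ?_, fun h2 => hk _ ?_, fun h1 => ?_⟩
  · have hall : ∀ i, IsSmoothVector (z i) := by
      intro i
      have h : {i | IsSmoothVector (z i)} = Set.univ := by
        refine Set.eq_of_subset_of_ncard_le (Set.subset_univ _) ?_
        rw [Set.ncard_univ, Nat.card_eq_fintype_card, Fintype.card_fin]
        exact h4.ge
      exact h.ge (Set.mem_univ i)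
    have hallc : ∀ i, IsSmoothVector (T (cubeVertex i)) := fun i => (hsmooth i).2 (hall i)
    refine ⟨fun h => hk _ ?_, fun h => hk _ ?_⟩
    · have heq : ∀ j, supportSpan (z j) = supportSpan (z 0) := by
        intro j
        rw [← hspan, ← hspan]
        rcases h with h | h
        · exact supportSpan_eq_of_finrank_range_eq_one h (hc j) (hc 0)
        rcases eq_or_ne j 0 with rfl | hj
        · rfl
        rcases h j 0 hj with h | h
        · exact h.supportSpan_eq (hallc j) (hallc 0)
        · rw [h.supportSpan_eq (hallc j) (isSmoothVector_neg.2 (hallc 0)), supportSpan_neg]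
      have := hline 0 (hall 0) fun j _ => heq j
      omega
    · push Not at h
      obtain ⟨-, i, j, -, h, h'⟩ := h
      have hij : supportSpan (z i) ≠ supportSpan (z j) := by
        rw [← hspan, ← hspan]
        intro he
        rcases (hallc i).onCommonSphereSegment (hallc j) he with hs | hs
        exacts [h hs, h' hs]
      have h0 := finrank_iInf_supportSpan_eq_zero hall hij
      change _ + Module.finrank ℝ (⨅ i, supportSpan (z i) : Submodule ℝ (Y →L[ℝ] ℝ)) =
        ∑ i, Module.finrank ℝ (supportSpan (z i)) at hdim
      omega
  · have := hmixed (by omega) (by omega)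
    omega
  · have := hmixed (by omega) (by omega)
    omega
  -- Here `n < 2`, and `hne` excludes `n = 1`.
  · have h0 : n = 0 := by omega
    have hempty : {i | IsSmoothVector (z i)} = ∅ := (Set.ncard_eq_zero).1 h0
    refine ⟨hempty, hk _ ?_⟩
    have hns : ∀ i, ¬ IsSmoothVector (z i) := fun i hi => hempty.le (show i ∈ _ from hi)
    have htop : ⨅ i, supportSpan (z i) = ⊤ := by
      rw [iInf_supportSpan_eq hY hz (i := 0) fun j hj => absurd hj (hns j),
        supportSpan_eq_top_of_not_isSmoothVector hY (hz 0) (hns 0)]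
    change _ + Module.finrank ℝ (⨅ i, supportSpan (z i) : Submodule ℝ (Y →L[ℝ] ℝ)) =
      ∑ i, Module.finrank ℝ (supportSpan (z i)) at hdim
    rw [htop, finrank_top, finrank_continuousDual, hY] at hdim
    omega
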